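/- Consider a base station with $M\ge 2$ antennas and two single-antenna users with channels $\sqrt{\beta_k}\,h_k$, $k=1,2$, where $\beta_1\ge\beta_2>0$ and $h_1,h_2$ are independent with law $\mathcal{CN}(0,I_M)$. Let $\rho=|h_1^Hh_2|/(\|h_1\|\,\|h_2\|)$, let $b=h_1/\|h_1\|$ be the matched-filter beamformer, and put $g_k=\beta_k|b^Hh_k|^2$. For SINR requirements $\gamma_1,\gamma_2>0$, powers $P_1,P_2\ge 0$ meet the requirements if $P_1g_1\ge\gamma_1$ and $\frac{P_2g_k}{1+P_1g_k}\ge\gamma_2$ for $k=1,2$; the least total power $P_1+P_2$ for which this is possible is $$P_{\min}=\frac{\gamma_1(1+\gamma_2)}{g_1}+\frac{\gamma_2}{\min(g_1,g_2)}.$$ For a threshold $\rho_{th}\ge 0$ the base station transmits only when $\rho\ge\rho_{th}$, and $\mathbb E[P_{\min}]$ denotes the expectation of $P_{\min}$ conditional on $\rho\ge\rho_{th}$ (taken as $0$ if $\rho_{th}\ge 1$, when the base station is almost surely silent). Then: 1. $\mathbb E[P_{\min}]<\infty$ for every $\rho_{th}>0$; 2. $\mathbb E[P_{\min}]\to\infty$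 as $\rho_{th}\to 0^+$; 3. for $\rho_{th}=0$ (original NOMA) $\mathbb E[P_{\min}]=\infty$, and every choice of random powers $P_1,P_2\ge0$ that meets the SINR requirements almost surely has $\mathbb E[P_1+P_2]=\infty$. -/

import Mathlib

open MeasureTheory ProbabilityTheory Filter Topology
open scoped ENNReal NNReal

noncomputable section

namespace NOMA

/-- The circularly symmetric complex Gaussian law `CN(0, 1)` on `ℂ`: real and imaginary part are
independent, each with law `N(0, 1/2)`. -/
def stdComplexGaussian : Measure ℂ :=
  ((gaussianReal 0 (1 / 2)).prod (gaussianReal 0 (1 / 2))).map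
    (fun p : ℝ × ℝ => (⟨p.1, p.2⟩ : ℂ))

/-- The law `CN(0, I_M)` on `ℂ^M`: the entries are i.i.d. with law `CN(0, 1)`. -/
def stdComplexGaussianVec (M : ℕ) : Measure (EuclideanSpace ℂ (Fin M)) :=
  (Measure.pi (fun _ : Fin M => stdComplexGaussian)).map (WithLp.toLp 2)

/-- Absolute correlation coefficient `|h₁ᴴ h₂| / (‖h₁‖ ‖h₂‖)` of two channel vectors. -/
def absCorr {M : ℕ} (h₁ h₂ : EuclideanSpace ℂ (Fin M)) : ℝ :=
  ‖inner ℂ h₁ h₂‖ / (‖h₁‖ * ‖h₂‖)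

/-- Matched-filter beamformer `h₁ / ‖h₁‖` along the channel of user 1. -/
def matchedFilter {M : ℕ} (h₁ : EuclideanSpace ℂ (Fin M)) : EuclideanSpace ℂ (Fin M) :=
  ((‖h₁‖⁻¹ : ℝ) : ℂ) • h₁

/-- Received power gain `β |bᴴ h|²` under beamformer `b`, small-scale channel `h` and
large-scale coefficient `β`. -/
def gain {M : ℕ} (β : ℝ) (b h : EuclideanSpace ℂ (Fin M)) : ℝ :=
  β * ‖inner ℂ b h‖ ^ 2

/-- SINR for decoding `s₁` without interference, at a receiver with gain `g` (unit noise). -/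
def sinrOne (P₁ g : ℝ) : ℝ := P₁ * g

/-- SINR for decoding `s₂` with `s₁` treated as noise, at a receiver with gain `g`
(unit noise). -/
def sinrTwo (P₁ P₂ g : ℝ) : ℝ := P₂ * g / (1 + P₁ * g)

/-- The powers `P₁, P₂` meet the SINR requirements `γ₁, γ₂`: both users can decode `s₂`
(treating `s₁` as noise), and user 1 can decode `s₁` after cancelling `s₂`.
Here `g₁, g₂` are the gains of the two users. -/
def MeetsSINR (γ₁ γ₂ g₁ g₂ P₁ P₂ : ℝ) : Prop :=
  0 ≤ P₁ ∧ 0 ≤ P₂ ∧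
    γ₂ ≤ min (sinrTwo P₁ P₂ g₁) (sinrTwo P₁ P₂ g₂) ∧ γ₁ ≤ sinrOne P₁ g₁

/-- Minimal total power for gains `g₁, g₂` (with value `∞` if a gain vanishes). -/
def minPowerOfGains (γ₁ γ₂ g₁ g₂ : ℝ) : ℝ≥0∞ :=
  ENNReal.ofReal (γ₁ * (1 + γ₂)) / ENNReal.ofReal g₁ +
    ENNReal.ofReal γ₂ / ENNReal.ofReal (min g₁ g₂)

/-- Minimal total transmit power `P_min` with the matched-filter beamformer. -/
def minPower {M : ℕ} (β₁ β₂ γ₁ γ₂ : ℝ) (h₁ h₂ : EuclideanSpace ℂ (Fin M)) : ℝ≥0∞ :=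
  minPowerOfGains γ₁ γ₂ (gain β₁ (matchedFilter h₁) h₁) (gain β₂ (matchedFilter h₁) h₂)

/-- Average minimal transmit power of correlation-based NOMA with threshold `ρth`: the
expectation of `P_min` given that the base station transmits, i.e. that the absolute
correlation coefficient is at least `ρth`. For `ρth = 0` there is no constraint. -/
def avgMinPower {M : ℕ} {Ω : Type*} [MeasurableSpace Ω] (μ : Measure Ω) (β₁ β₂ γ₁ γ₂ : ℝ)
    (h₁ h₂ : Ω → EuclideanSpace ℂ (Fin M)) (ρth : ℝ) : ℝ≥0∞ :=
  ∫⁻ ω, minPower β₁ β₂ γ₁ γ₂ (h₁ ω) (h₂ ω) ∂(μ[|{ω | ρth ≤ absCorr (h₁ ω) (h₂ ω)}])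

/-- The closed form is the least total power over all power allocations that meet the SINR
requirements. -/
theorem minPowerOfGains_eq_iInf {γ₁ γ₂ g₁ g₂ : ℝ} (hγ₁ : 0 < γ₁) (hγ₂ : 0 < γ₂)
    (hg₁ : 0 ≤ g₁) (hg₂ : 0 ≤ g₂) :
    minPowerOfGains γ₁ γ₂ g₁ g₂ =
      ⨅ (P₁ : ℝ) (P₂ : ℝ) (_ : MeetsSINR γ₁ γ₂ g₁ g₂ P₁ P₂), ENNReal.ofReal (P₁ + P₂) := by
  by_cases hpos : 0 < g₁ ∧ 0 < g₂
  · obtain ⟨h1, h2⟩ := hpos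
    have hm : 0 < min g₁ g₂ := lt_min h1 h2
    have hval : minPowerOfGains γ₁ γ₂ g₁ g₂ =
        ENNReal.ofReal (γ₁ * (1 + γ₂) / g₁ + γ₂ / min g₁ g₂) := by
      rw [minPowerOfGains, ENNReal.ofReal_add (by positivity) (by positivity),
        ENNReal.ofReal_div_of_pos h1, ENNReal.ofReal_div_of_pos hm]
    rw [hval]
    apply le_antisymm
    · refine le_iInf fun P₁ => le_iInf fun P₂ => le_iInf fun h => ENNReal.ofReal_le_ofReal ?_
      obtain ⟨hP₁, hP₂, hs, hs1⟩ := h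
      obtain ⟨ha, hb⟩ := le_min_iff.1 hs
      have key : ∀ g : ℝ, 0 < g → γ₂ ≤ sinrTwo P₁ P₂ g → γ₂ / g + γ₂ * P₁ ≤ P₂ := by
        intro g hg h
        rw [sinrTwo, le_div_iff₀ (by positivity)] at h
        have e : γ₂ / g + γ₂ * P₁ = γ₂ * (1 + P₁ * g) / g := by field_simp
        rw [e, div_le_iff₀ hg]
        exact h
      have k : γ₂ / min g₁ g₂ + γ₂ * P₁ ≤ P₂ := by
        rcases min_choice g₁ g₂ with h | h <;> rw [h]
        · exact key _ h1 ha
        · exact key _ h2 hb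
      have k1 : γ₁ / g₁ ≤ P₁ := (div_le_iff₀ h1).2 hs1
      have e : γ₁ * (1 + γ₂) / g₁ = (1 + γ₂) * (γ₁ / g₁) := by ring
      rw [e]
      nlinarith [mul_le_mul_of_nonneg_left k1 (by positivity : (0 : ℝ) ≤ 1 + γ₂)]
    · refine (iInf₂_le (γ₁ / g₁) (γ₂ / min g₁ g₂ + γ₂ * (γ₁ / g₁))).trans
        ((iInf_le _ ?_).trans (le_of_eq ?_))
      · have key : ∀ g : ℝ, 0 < g → min g₁ g₂ ≤ g →
            γ₂ ≤ sinrTwo (γ₁ / g₁) (γ₂ / min g₁ g₂ + γ₂ * (γ₁ / g₁)) g := by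
          intro g hg hle
          rw [sinrTwo, le_div_iff₀ (by positivity)]
          have : γ₂ ≤ γ₂ / min g₁ g₂ * g := by
            rw [div_mul_eq_mul_div, le_div_iff₀ hm]
            exact mul_le_mul_of_nonneg_left hle hγ₂.le
          nlinarith
        refine ⟨by positivity, by positivity,
          le_min (key _ h1 (min_le_left _ _)) (key _ h2 (min_le_right _ _)), ?_⟩
        rw [sinrOne, div_mul_cancel₀ _ h1.ne']
      · congr 1
        ring
  · have hm : min g₁ g₂ = 0 := by
      rcases hg₁.eq_or_lt with h | h
      · rw [← h]
        exact min_eq_left hg₂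
      · rcases hg₂.eq_or_lt with h' | h'
        · rw [← h']
          exact min_eq_right hg₁
        · exact absurd ⟨h, h'⟩ hpos
    have hL : minPowerOfGains γ₁ γ₂ g₁ g₂ = ⊤ := by
      rw [minPowerOfGains, hm, ENNReal.ofReal_zero, ENNReal.div_zero (by simpa using hγ₂)]
      simp
    rw [hL, eq_comm]
    simp only [iInf_eq_top]
    rintro P₁ P₂ ⟨_, _, hs, _⟩
    obtain ⟨ha, hb⟩ := le_min_iff.1 hs
    exfalso
    rcases min_choice g₁ g₂ with h | h
    · rw [h] at hm
      simp only [sinrTwo, hm, mul_zero, zero_div] at ha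
      linarith
    · rw [h] at hm
      simp only [sinrTwo, hm, mul_zero, zero_div] at hb
      linarith

end NOMA

end

/-!
Write `b` for the matched filter of `h₁` and `ρ` for the absolute correlation of `h₁`, `h₂`, so
that `g₁ = β₁ ‖h₁‖²` and `g₂ = β₂ |bᴴ h₂|² = β₂ ρ² ‖h₂‖²`.

*Finiteness.* On `ρ ≥ t > 0` the minimal power is at most a constant times `‖h₁‖⁻² + ‖h₂‖⁻²`
(`NOMA.minPower_le_of_le_absCorr`), and `𝔼 ‖h‖⁻² < ∞` in complex dimension at least two
(`NOMA.lintegral_inv_sq_norm_stdComplexGaussianVec_lt_top`). For the latter, applying the inequality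
of arithmetic and geometric means to two complex entries, and then to their real and imaginary
parts, bounds `‖h‖⁻²` by a product of four independent factors `|x|^(-1/2)` with `x` real Gaussian,
each of finite mean.

*Divergence.* The minimal power dominates a constant times `|bᴴ h₂|⁻²`. For a fixed direction `b`,
freezing all entries of `h₂` but one turns `bᴴ h₂` into a nonconstant affine function `c z + w` of
a complex Gaussian `z`, whose density is bounded below near the zero of that function; hence the
mean of `|bᴴ h₂|⁻²` is infinite because `1 / (x² + y²)` is not integrable near the origin of the
plane (`NOMA.lintegral_inv_sq_norm_inner_stdComplexGaussianVec`). Real inverses, with `0⁻¹ = 0`,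
are used in these lower bounds, so the integral is infinite already over `ρ > 0`
(`NOMA.setLIntegral_minPower_absCorr_pos`). The events `ρ ≥ t` increase to `ρ > 0` as `t → 0⁺`, so
monotone convergence gives the limit; without a threshold, the power allocations are handled by the
pointwise minimality `NOMA.minPowerOfGains_eq_iInf`.
-/

namespace NOMA

/-! ### Gaussian integrals on the real line -/

lemma exists_smul_restrict_Icc_le_gaussianReal (m : ℝ) {v : ℝ≥0} (hv : v ≠ 0) (a b : ℝ) :
    ∃ c : ℝ≥0∞, c ≠ 0 ∧ c • volume.restrict (Set.Icc a b) ≤ gaussianReal m v := by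
  rcases (Set.Icc a b).eq_empty_or_nonempty with he | hne
  · exact ⟨1, one_ne_zero, by simp [he, Measure.zero_le]⟩
  · have hcont : Continuous (gaussianPDFReal m v) := by
      unfold gaussianPDFReal
      fun_prop
    obtain ⟨x₀, -, hx₀⟩ := isCompact_Icc.exists_isMinOn hne hcont.continuousOn
    refine ⟨gaussianPDF m v x₀, (gaussianPDF_pos m hv x₀).ne', ?_⟩
    rw [gaussianReal_of_var_ne_zero m hv, ← withDensity_const]
    refine (withDensity_indicator measurableSet_Icc fun _ => gaussianPDF m v x₀).symm.trans_le ?_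
    refine withDensity_mono (ae_of_all _ fun x => ?_)
    refine Set.indicator_apply_le fun hx => ?_
    exact ENNReal.ofReal_le_ofReal (hx₀ hx)

lemma lintegral_inv_sqrt_abs_gaussianReal_lt_top :
    ∫⁻ x, (ENNReal.ofReal √|x|)⁻¹ ∂(gaussianReal 0 (1 / 2)) < ∞ := by
  have hint : Integrable fun x : ℝ => ‖x‖ ^ (-1 / 2 : ℝ) * Real.exp (-1 * ‖x‖ ^ 2) := by
    rw [integrable_fun_norm_addHaar volume
      (f := fun y : ℝ => y ^ (-1 / 2 : ℝ) * Real.exp (-1 * y ^ 2))]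
    simpa using integrableOn_rpow_mul_exp_neg_mul_sq (b := 1) (s := -1 / 2) one_pos (by norm_num)
  have hfin := (hint.const_mul (√Real.pi)⁻¹).lintegral_lt_top
  rw [gaussianReal_of_var_ne_zero 0 (by norm_num : (1 / 2 : ℝ≥0) ≠ 0),
    lintegral_withDensity_eq_lintegral_mul _ (measurable_gaussianPDF _ _) (by fun_prop)]
  refine lt_of_eq_of_lt (lintegral_congr_ae ?_) hfin
  filter_upwards [Measure.ae_ne volume (0 : ℝ)] with x hx
  have hx' : 0 < |x| := abs_pos.2 hx
  rw [Pi.mul_apply, ← ENNReal.ofReal_inv_of_pos (by positivity), gaussianPDF,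
    ← ENNReal.ofReal_mul (gaussianPDFReal_nonneg _ _ _), gaussianPDFReal]
  congr 1
  rw [Real.sqrt_eq_rpow |x|, ← Real.rpow_neg hx'.le, Real.norm_eq_abs, sq_abs]
  have hpi : 2 * Real.pi * ((1 / 2 : ℝ≥0) : ℝ) = Real.pi := by
    push_cast
    ring
  rw [hpi]
  norm_num
  ring

lemma lintegral_inv_Icc_zero_one : ∫⁻ x in Set.Icc (0 : ℝ) 1, ENNReal.ofReal x⁻¹ = ∞ := by
  by_contra h
  have hni : ¬ IntervalIntegrable (fun x : ℝ => x⁻¹) volume 0 1 := by simp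
  refine hni ((intervalIntegrable_iff_integrableOn_Icc_of_le zero_le_one).2
    ((lintegral_ofReal_ne_top_iff_integrable (by fun_prop) ?_).1 h))
  filter_upwards [ae_restrict_mem measurableSet_Icc] with x hx using inv_nonneg.2 hx.1

/-- The function `1 / (x² + y²)` is not integrable near the origin of the plane. -/
lemma lintegral_inv_sq_add_sq_Icc_zero_one :
    ∫⁻ x in Set.Icc (0 : ℝ) 1, ∫⁻ y in Set.Icc (0 : ℝ) 1,
      ENNReal.ofReal (x ^ 2 + y ^ 2)⁻¹ = ∞ := by
  -- On `0 ≤ y ≤ x` the integrand is at least `1 / (2 x²)`, so the inner integral is at least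
  -- `1 / (2 x)`.
  have hinner : ∀ x ∈ Set.Icc (0 : ℝ) 1, ENNReal.ofReal 2⁻¹ * ENNReal.ofReal x⁻¹ ≤
      ∫⁻ y in Set.Icc (0 : ℝ) 1, ENNReal.ofReal (x ^ 2 + y ^ 2)⁻¹ := by
    rintro x ⟨hx0, hx1⟩
    rcases hx0.eq_or_lt with rfl | hx0
    · simp
    calc ENNReal.ofReal 2⁻¹ * ENNReal.ofReal x⁻¹
        = ∫⁻ _ in Set.Icc (0 : ℝ) x, ENNReal.ofReal (2 * x ^ 2)⁻¹ := by
          rw [setLIntegral_const, Real.volume_Icc, ← ENNReal.ofReal_mul (by positivity),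
            ← ENNReal.ofReal_mul (by positivity)]
          congr 1
          field_simp
          simp
      _ ≤ ∫⁻ y in Set.Icc (0 : ℝ) x, ENNReal.ofReal (x ^ 2 + y ^ 2)⁻¹ := by
          refine setLIntegral_mono' measurableSet_Icc fun y hy => ENNReal.ofReal_le_ofReal ?_
          refine inv_anti₀ (by positivity) ?_
          nlinarith [hy.1, hy.2]
      _ ≤ _ := lintegral_mono_set (Set.Icc_subset_Icc_right hx1)
  refine top_le_iff.1 ((le_of_eq ?_).trans (setLIntegral_mono' measurableSet_Icc hinner))
  rw [lintegral_const_mul _ (by fun_prop), lintegral_inv_Icc_zero_one,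
    ENNReal.mul_top (by simp)]

lemma lintegral_inv_sq_add_sq_gaussianReal (a b : ℝ) :
    ∫⁻ x, ∫⁻ y, ENNReal.ofReal ((x - a) ^ 2 + (y - b) ^ 2)⁻¹ ∂(gaussianReal 0 (1 / 2))
      ∂(gaussianReal 0 (1 / 2)) = ∞ := by
  have hv : (1 / 2 : ℝ≥0) ≠ 0 := by norm_num
  have key : ∀ a : ℝ, ∃ c : ℝ≥0∞, c ≠ 0 ∧ ∀ f : ℝ → ℝ≥0∞,
      c * ∫⁻ x in Set.Icc (0 : ℝ) 1, f x ≤ ∫⁻ x, f (x - a) ∂(gaussianReal 0 (1 / 2)) := by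
    intro a
    obtain ⟨c, hc, hle⟩ := exists_smul_restrict_Icc_le_gaussianReal 0 hv a (a + 1)
    refine ⟨c, hc, fun f => le_trans (le_of_eq ?_) (lintegral_mono' hle le_rfl)⟩
    rw [lintegral_smul_measure, smul_eq_mul, ← lintegral_indicator measurableSet_Icc,
      ← lintegral_indicator measurableSet_Icc, ← lintegral_sub_right_eq_self _ a]
    congr 2
    ext x
    simp only [Set.indicator_apply, Set.mem_Icc, sub_nonneg, sub_le_iff_le_add, add_comm]
  obtain ⟨c, hc, hca⟩ := key a
  obtain ⟨d, hd, hdb⟩ := key b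
  refine top_le_iff.1 (le_trans (le_of_eq ?_) ((hca fun x => d * ∫⁻ y in Set.Icc (0 : ℝ) 1,
    ENNReal.ofReal (x ^ 2 + y ^ 2)⁻¹).trans
      (lintegral_mono fun x => hdb fun y => ENNReal.ofReal ((x - a) ^ 2 + y ^ 2)⁻¹)))
  rw [lintegral_const_mul, lintegral_inv_sq_add_sq_Icc_zero_one, ENNReal.mul_top hd,
    ENNReal.mul_top hc]
  exact Measurable.lintegral_prod_right (by fun_prop)

/-! ### Complex Gaussian variables -/

instance : IsProbabilityMeasure stdComplexGaussian :=
  Measure.isProbabilityMeasure_map Complex.measurableEquivRealProd.symm.measurable.aemeasurable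

lemma lintegral_stdComplexGaussian {f : ℂ → ℝ≥0∞} (hf : Measurable f) :
    ∫⁻ z, f z ∂stdComplexGaussian =
      ∫⁻ x, ∫⁻ y, f ⟨x, y⟩ ∂(gaussianReal 0 (1 / 2)) ∂(gaussianReal 0 (1 / 2)) := by
  have hmeas : Measurable fun p : ℝ × ℝ => (⟨p.1, p.2⟩ : ℂ) :=
    Complex.measurableEquivRealProd.symm.measurable
  rw [stdComplexGaussian, lintegral_map hf hmeas]
  exact lintegral_prod _ (hf.comp hmeas).aemeasurable

lemma lintegral_inv_norm_stdComplexGaussian_lt_top :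
    ∫⁻ z, (ENNReal.ofReal ‖z‖)⁻¹ ∂stdComplexGaussian < ∞ := by
  have hle : ∀ x y : ℝ, (ENNReal.ofReal ‖(⟨x, y⟩ : ℂ)‖)⁻¹ ≤
      (ENNReal.ofReal √|x|)⁻¹ * (ENNReal.ofReal √|y|)⁻¹ := by
    intro x y
    rw [← ENNReal.mul_inv (by simp) (by simp), ← ENNReal.ofReal_mul (by positivity),
      ENNReal.inv_le_inv, ← Real.sqrt_mul (abs_nonneg x)]
    refine ENNReal.ofReal_le_ofReal (Real.sqrt_le_iff.2 ⟨norm_nonneg _, ?_⟩)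
    rw [Complex.sq_norm, Complex.normSq_mk]
    nlinarith [sq_nonneg (|x| - |y|), sq_abs x, sq_abs y, mul_nonneg (abs_nonneg x) (abs_nonneg y)]
  rw [lintegral_stdComplexGaussian (by fun_prop)]
  refine (lintegral_mono fun x => lintegral_mono fun y => hle x y).trans_lt ?_
  simp_rw [lintegral_const_mul _ (by fun_prop : Measurable fun y : ℝ => (ENNReal.ofReal √|y|)⁻¹)]
  rw [lintegral_mul_const _ (by fun_prop)]
  exact ENNReal.mul_lt_top lintegral_inv_sqrt_abs_gaussianReal_lt_top
    lintegral_inv_sqrt_abs_gaussianReal_lt_top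

/-- No nonconstant affine function of a complex Gaussian variable has a finite inverse second
moment. The real inverse takes the value `0` at the zero of the affine function, so the
divergence is not due to a point mass there. -/
lemma lintegral_inv_sq_norm_affine_stdComplexGaussian {c : ℂ} (hc : c ≠ 0) (w : ℂ) :
    ∫⁻ z, ENNReal.ofReal (‖c * z + w‖ ^ 2)⁻¹ ∂stdComplexGaussian = ∞ := by
  rw [lintegral_stdComplexGaussian (by fun_prop)]
  have heq : ∀ x y : ℝ, ENNReal.ofReal (‖c * ⟨x, y⟩ + w‖ ^ 2)⁻¹ =
      ENNReal.ofReal (‖c‖ ^ 2)⁻¹ *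
        ENNReal.ofReal ((x - (-w / c).re) ^ 2 + (y - (-w / c).im) ^ 2)⁻¹ := by
    intro x y
    have h : c * ⟨x, y⟩ + w = c * (⟨x, y⟩ - -w / c) := by
      field_simp
      ring
    rw [h, norm_mul, mul_pow, mul_inv, ENNReal.ofReal_mul (by positivity),
      Complex.sq_norm (_ - _), Complex.normSq_apply]
    simp only [Complex.sub_re, Complex.sub_im, sq]
  simp_rw [heq]
  simp_rw [lintegral_const_mul' _ _ ENNReal.ofReal_ne_top]
  rw [lintegral_inv_sq_add_sq_gaussianReal, ENNReal.mul_top]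
  simpa using hc

/-! ### Complex Gaussian vectors -/

lemma lintegral_stdComplexGaussianVec {M : ℕ} {f : EuclideanSpace ℂ (Fin M) → ℝ≥0∞}
    (hf : Measurable f) :
    ∫⁻ h, f h ∂(stdComplexGaussianVec M) =
      ∫⁻ z, f (WithLp.toLp 2 z) ∂(Measure.pi fun _ : Fin M => stdComplexGaussian) :=
  lintegral_map hf (by fun_prop)

instance (M : ℕ) : IsProbabilityMeasure (stdComplexGaussianVec M) :=
  Measure.isProbabilityMeasure_map (by fun_prop)

/-- In dimension at least two a standard complex Gaussian vector has a finite inverse second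
moment: by the inequality of arithmetic and geometric means, `‖h‖²` dominates the product of the
moduli of two independent entries, each with a finite inverse first moment. -/
lemma lintegral_inv_sq_norm_stdComplexGaussianVec_lt_top {M : ℕ} (hM : 2 ≤ M) :
    ∫⁻ h, (ENNReal.ofReal (‖h‖ ^ 2))⁻¹ ∂(stdComplexGaussianVec M) < ∞ := by
  rw [lintegral_stdComplexGaussianVec (by fun_prop)]
  let i : Fin M := ⟨0, by omega⟩
  let j : Fin M := ⟨1, by omega⟩
  have hij : i ≠ j := by simp [i, j]
  have hle : ∀ z : Fin M → ℂ, (ENNReal.ofReal (‖WithLp.toLp 2 z‖ ^ 2))⁻¹ ≤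
      (ENNReal.ofReal ‖z i‖)⁻¹ * (ENNReal.ofReal ‖z j‖)⁻¹ := by
    intro z
    rw [← ENNReal.mul_inv (by simp) (by simp), ← ENNReal.ofReal_mul (norm_nonneg _),
      ENNReal.inv_le_inv, EuclideanSpace.norm_sq_eq]
    refine ENNReal.ofReal_le_ofReal (le_trans ?_ (Finset.sum_le_sum_of_subset_of_nonneg
      (Finset.subset_univ {i, j}) fun _ _ _ => sq_nonneg _))
    rw [Finset.sum_pair hij]
    nlinarith [sq_nonneg (‖z i‖ - ‖z j‖), sq_nonneg (‖z i‖ + ‖z j‖)]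
  have hind := (iIndepFun_pi (μ := fun _ : Fin M => stdComplexGaussian)
    (X := fun _ z => (ENNReal.ofReal ‖z‖)⁻¹) fun _ => by fun_prop).indepFun hij
  have hev : ∀ k : Fin M, ∫⁻ z : Fin M → ℂ, (ENNReal.ofReal ‖z k‖)⁻¹
      ∂(Measure.pi fun _ : Fin M => stdComplexGaussian) < ∞ := by
    intro k
    have := (measurePreserving_eval (fun _ : Fin M => stdComplexGaussian) k).lintegral_comp
      (f := fun z => (ENNReal.ofReal ‖z‖)⁻¹) (by fun_prop)
    simp only [Function.eval] at this
    rw [this]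
    exact lintegral_inv_norm_stdComplexGaussian_lt_top
  have hmeas : ∀ k : Fin M, Measurable fun z : Fin M → ℂ => (ENNReal.ofReal ‖z k‖)⁻¹ :=
    fun k => by fun_prop
  refine (lintegral_mono hle).trans_lt ?_
  rw [lintegral_mul_eq_lintegral_mul_lintegral_of_indepFun'' (hmeas i).aemeasurable
    (hmeas j).aemeasurable hind]
  exact ENNReal.mul_lt_top (hev i) (hev j)

lemma ae_ne_zero_stdComplexGaussianVec {M : ℕ} (hM : 2 ≤ M) :
    ∀ᵐ h ∂(stdComplexGaussianVec M), h ≠ 0 := by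
  filter_upwards [ae_lt_top (by fun_prop)
    (lintegral_inv_sq_norm_stdComplexGaussianVec_lt_top hM).ne] with h hh
  rintro rfl
  simp at hh

/-- The component of a standard complex Gaussian vector along a fixed nonzero direction has an
infinite inverse second moment: conditionally on all entries but one for which the direction has a
nonzero coordinate, it is a nonconstant affine function of that entry. -/
lemma lintegral_inv_sq_norm_inner_stdComplexGaussianVec {M : ℕ} {b : EuclideanSpace ℂ (Fin M)}
    (hb : b ≠ 0) :
    ∫⁻ h, ENNReal.ofReal (‖inner ℂ b h‖ ^ 2)⁻¹ ∂(stdComplexGaussianVec M) = ∞ := by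
  obtain ⟨i, hi⟩ : ∃ i, b i ≠ 0 := by
    by_contra! h
    exact hb (PiLp.ext h)
  obtain ⟨n, rfl⟩ : ∃ n, M = n + 1 := ⟨M - 1, by have := i.pos; omega⟩
  rw [lintegral_stdComplexGaussianVec (by fun_prop),
    ← (measurePreserving_piFinSuccAbove (fun _ => stdComplexGaussian) i).symm.lintegral_comp
      (by fun_prop), lintegral_prod_symm _ (by fun_prop)]
  have hinner : ∀ (z : ℂ) (r : Fin n → ℂ),
      inner ℂ b (WithLp.toLp 2 ((MeasurableEquiv.piFinSuccAbove (fun _ => ℂ) i).symm (z, r))) =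
        starRingEnd ℂ (b i) * z + ∑ k, r k * starRingEnd ℂ (b (i.succAbove k)) := by
    intro z r
    simp [PiLp.inner_apply, Fin.sum_univ_succAbove _ i, MeasurableEquiv.piFinSuccAbove_symm_apply,
      mul_comm]
  simp_rw [hinner,
    lintegral_inv_sq_norm_affine_stdComplexGaussian ((map_ne_zero (starRingEnd ℂ)).2 hi)]
  simp

/-! ### The minimal power -/

section

variable {M : ℕ} {β₁ β₂ γ₁ γ₂ : ℝ}

lemma gain_nonneg {β : ℝ} (hβ : 0 ≤ β) (b h : EuclideanSpace ℂ (Fin M)) : 0 ≤ gain β b h :=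
  mul_nonneg hβ (sq_nonneg _)

lemma absCorr_nonneg (h₁ h₂ : EuclideanSpace ℂ (Fin M)) : 0 ≤ absCorr h₁ h₂ :=
  div_nonneg (norm_nonneg _) (by positivity)

lemma measurable_matchedFilter : Measurable (matchedFilter (M := M)) := by
  unfold matchedFilter
  fun_prop

lemma measurable_absCorr :
    Measurable fun p : EuclideanSpace ℂ (Fin M) × EuclideanSpace ℂ (Fin M) =>
      absCorr p.1 p.2 := by
  unfold absCorr
  fun_prop

lemma norm_inner_matchedFilter (h₁ h₂ : EuclideanSpace ℂ (Fin M)) :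
    ‖inner ℂ (matchedFilter h₁) h₂‖ = absCorr h₁ h₂ * ‖h₂‖ := by
  rcases eq_or_ne h₂ 0 with rfl | h
  · simp
  · have : ‖h₂‖ ≠ 0 := norm_ne_zero_iff.2 h
    rw [matchedFilter, absCorr, inner_smul_left, norm_mul, RCLike.norm_conj, Complex.norm_real,
      norm_inv, norm_norm]
    field_simp

lemma gain_matchedFilter_self (β : ℝ) (h : EuclideanSpace ℂ (Fin M)) :
    gain β (matchedFilter h) h = β * ‖h‖ ^ 2 := by
  rcases eq_or_ne h 0 with rfl | hh
  · simp [gain]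
  · have : ‖h‖ ≠ 0 := norm_ne_zero_iff.2 hh
    rw [gain, norm_inner_matchedFilter, absCorr, inner_self_eq_norm_sq_to_K, norm_pow,
      RCLike.norm_ofReal, abs_norm]
    field_simp

lemma le_minPower (hβ₂ : 0 < β₂) (hγ₂ : 0 < γ₂) (h₁ h₂ : EuclideanSpace ℂ (Fin M)) :
    ENNReal.ofReal (γ₂ / β₂) * ENNReal.ofReal (‖inner ℂ (matchedFilter h₁) h₂‖ ^ 2)⁻¹ ≤
      minPower β₁ β₂ γ₁ γ₂ h₁ h₂ := by
  rcases eq_or_ne (inner ℂ (matchedFilter h₁) h₂) 0 with h | h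
  · simp [h]
  have hpos : 0 < gain β₂ (matchedFilter h₁) h₂ := by
    unfold gain
    positivity
  calc ENNReal.ofReal (γ₂ / β₂) * ENNReal.ofReal (‖inner ℂ (matchedFilter h₁) h₂‖ ^ 2)⁻¹
      = ENNReal.ofReal γ₂ / ENNReal.ofReal (gain β₂ (matchedFilter h₁) h₂) := by
        rw [← ENNReal.ofReal_div_of_pos hpos, ← ENNReal.ofReal_mul (by positivity), gain]
        congr 1
        field_simp
    _ ≤ ENNReal.ofReal γ₂ / ENNReal.ofReal (min (gain β₁ (matchedFilter h₁) h₁)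
          (gain β₂ (matchedFilter h₁) h₂)) :=
        ENNReal.div_le_div_left (ENNReal.ofReal_le_ofReal (min_le_right _ _)) _
    _ ≤ _ := le_add_self

/-- Above a positive correlation threshold the minimal power is controlled by the inverse squared
norms of the two channels, because `g₂ = β₂ ρ² ‖h₂‖²`. -/
lemma minPower_le_of_le_absCorr (hβ₁ : 0 < β₁) (hβ₂ : 0 < β₂) {t : ℝ}
    (ht : 0 < t) {h₁ h₂ : EuclideanSpace ℂ (Fin M)} (h : t ≤ absCorr h₁ h₂) :
    minPower β₁ β₂ γ₁ γ₂ h₁ h₂ ≤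
      (ENNReal.ofReal (γ₁ * (1 + γ₂)) + ENNReal.ofReal γ₂) * (ENNReal.ofReal β₁)⁻¹ *
          (ENNReal.ofReal (‖h₁‖ ^ 2))⁻¹ +
        ENNReal.ofReal γ₂ * (ENNReal.ofReal (β₂ * t ^ 2))⁻¹ * (ENNReal.ofReal (‖h₂‖ ^ 2))⁻¹ := by
  have hg₁ : ENNReal.ofReal (gain β₁ (matchedFilter h₁) h₁) =
      ENNReal.ofReal β₁ * ENNReal.ofReal (‖h₁‖ ^ 2) := by
    rw [gain_matchedFilter_self, ENNReal.ofReal_mul hβ₁.le]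
  have hg₂ : ENNReal.ofReal (β₂ * t ^ 2) * ENNReal.ofReal (‖h₂‖ ^ 2) ≤
      ENNReal.ofReal (gain β₂ (matchedFilter h₁) h₂) := by
    rw [← ENNReal.ofReal_mul (by positivity), gain, norm_inner_matchedFilter, mul_pow, mul_assoc]
    gcongr
  have hmin : (ENNReal.ofReal (min (gain β₁ (matchedFilter h₁) h₁)
      (gain β₂ (matchedFilter h₁) h₂)))⁻¹ ≤
      (ENNReal.ofReal β₁)⁻¹ * (ENNReal.ofReal (‖h₁‖ ^ 2))⁻¹ +
        (ENNReal.ofReal (β₂ * t ^ 2))⁻¹ * (ENNReal.ofReal (‖h₂‖ ^ 2))⁻¹ := by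
    rw [← ENNReal.mul_inv (by simp) (by simp), ← ENNReal.mul_inv (by simp) (by simp), ← hg₁]
    rcases min_choice (gain β₁ (matchedFilter h₁) h₁) (gain β₂ (matchedFilter h₁) h₂) with
      hm | hm <;> rw [hm]
    · exact le_self_add
    · exact (ENNReal.inv_le_inv.2 hg₂).trans le_add_self
  rw [minPower, minPowerOfGains, ENNReal.div_eq_inv_mul, ENNReal.div_eq_inv_mul, hg₁,
    ENNReal.mul_inv (by simp) (by simp)]
  refine (add_le_add le_rfl (mul_le_mul_left hmin _)).trans (le_of_eq ?_)
  ring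

end

/-! ### Averages over the channels -/

variable {Ω : Type*} [MeasurableSpace Ω] {μ : Measure Ω}
  {M : ℕ} {β₁ β₂ γ₁ γ₂ : ℝ} {h₁ h₂ : Ω → EuclideanSpace ℂ (Fin M)}

lemma avgMinPower_lt_top (hM : 2 ≤ M) (hβ₁ : 0 < β₁) (hβ₂ : 0 < β₂)
    (hlaw₁ : HasLaw h₁ (stdComplexGaussianVec M) μ)
    (hlaw₂ : HasLaw h₂ (stdComplexGaussianVec M) μ) {t : ℝ} (ht : 0 < t) :
    avgMinPower μ β₁ β₂ γ₁ γ₂ h₁ h₂ t < ∞ := by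
  have hcorr : AEMeasurable (fun ω => absCorr (h₁ ω) (h₂ ω)) μ :=
    measurable_absCorr.comp_aemeasurable (f := fun ω => (h₁ ω, h₂ ω))
      (hlaw₁.aemeasurable.prodMk hlaw₂.aemeasurable)
  have hnull : NullMeasurableSet {ω | t ≤ absCorr (h₁ ω) (h₂ ω)} μ :=
    hcorr.nullMeasurableSet_preimage measurableSet_Ici
  have hfin : ∀ h : Ω → EuclideanSpace ℂ (Fin M), HasLaw h (stdComplexGaussianVec M) μ →
      AEMeasurable (fun ω => (ENNReal.ofReal (‖h ω‖ ^ 2))⁻¹) μ ∧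
        ∫⁻ ω, (ENNReal.ofReal (‖h ω‖ ^ 2))⁻¹ ∂μ < ∞ := by
    intro h hlaw
    have hm : Measurable fun x : EuclideanSpace ℂ (Fin M) => (ENNReal.ofReal (‖x‖ ^ 2))⁻¹ := by
      fun_prop
    refine ⟨hm.comp_aemeasurable hlaw.aemeasurable, ?_⟩
    rw [← lintegral_map' (g := h) hm.aemeasurable hlaw.aemeasurable, hlaw.map_eq]
    exact lintegral_inv_sq_norm_stdComplexGaussianVec_lt_top hM
  rw [avgMinPower, ProbabilityTheory.cond, lintegral_smul_measure, smul_eq_mul]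
  rcases eq_or_ne (μ {ω | t ≤ absCorr (h₁ ω) (h₂ ω)}) 0 with h0 | h0
  · rw [Measure.restrict_eq_zero.2 h0]
    simp
  refine ENNReal.mul_lt_top (ENNReal.inv_lt_top.2 (pos_iff_ne_zero.2 h0)) ?_
  refine ((lintegral_mono_ae ((ae_restrict_mem₀ hnull).mono fun ω hω =>
    minPower_le_of_le_absCorr hβ₁ hβ₂ ht hω)).trans
      (lintegral_mono' Measure.restrict_le_self le_rfl)).trans_lt ?_
  rw [lintegral_add_left' ((hfin h₁ hlaw₁).1.const_mul _),
    lintegral_const_mul'' _ (hfin h₁ hlaw₁).1, lintegral_const_mul'' _ (hfin h₂ hlaw₂).1]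
  have h1 : (ENNReal.ofReal β₁)⁻¹ < ∞ := by simpa using hβ₁
  have h2 : (ENNReal.ofReal (β₂ * t ^ 2))⁻¹ < ∞ :=
    ENNReal.inv_lt_top.2 (ENNReal.ofReal_pos.2 (by positivity))
  exact ENNReal.add_lt_top.2
    ⟨ENNReal.mul_lt_top (ENNReal.mul_lt_top (by simp) h1) (hfin h₁ hlaw₁).2,
      ENNReal.mul_lt_top (ENNReal.mul_lt_top (by simp) h2) (hfin h₂ hlaw₂).2⟩

variable [IsProbabilityMeasure μ]

lemma lintegral_inv_sq_norm_inner_matchedFilter (hM : 2 ≤ M)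
    (hlaw₁ : HasLaw h₁ (stdComplexGaussianVec M) μ)
    (hlaw₂ : HasLaw h₂ (stdComplexGaussianVec M) μ) (hindep : IndepFun h₁ h₂ μ) :
    ∫⁻ ω, ENNReal.ofReal (‖inner ℂ (matchedFilter (h₁ ω)) (h₂ ω)‖ ^ 2)⁻¹ ∂μ = ∞ := by
  have hmap : μ.map (fun ω => (h₁ ω, h₂ ω)) =
      (stdComplexGaussianVec M).prod (stdComplexGaussianVec M) := by
    rw [(indepFun_iff_map_prod_eq_prod_map_map hlaw₁.aemeasurable hlaw₂.aemeasurable).1 hindep,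
      hlaw₁.map_eq, hlaw₂.map_eq]
  have hmf := measurable_matchedFilter (M := M)
  have hmeas : Measurable fun p : EuclideanSpace ℂ (Fin M) × EuclideanSpace ℂ (Fin M) =>
      ENNReal.ofReal (‖inner ℂ (matchedFilter p.1) p.2‖ ^ 2)⁻¹ := by fun_prop
  rw [← lintegral_map' (g := fun ω => (h₁ ω, h₂ ω)) hmeas.aemeasurable
    (hlaw₁.aemeasurable.prodMk hlaw₂.aemeasurable), hmap, lintegral_prod _ hmeas.aemeasurable]
  have hae : ∀ᵐ b ∂(stdComplexGaussianVec M), ∫⁻ h,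
      ENNReal.ofReal (‖inner ℂ (matchedFilter b) h‖ ^ 2)⁻¹ ∂(stdComplexGaussianVec M) = ∞ := by
    filter_upwards [ae_ne_zero_stdComplexGaussianVec hM] with b hb
    exact lintegral_inv_sq_norm_inner_stdComplexGaussianVec (by simpa [matchedFilter] using hb)
  rw [lintegral_congr_ae hae]
  simp

/-- The minimal power has infinite integral already over the channels with nonvanishing
correlation. -/
lemma setLIntegral_minPower_absCorr_pos (hM : 2 ≤ M) (hβ₂ : 0 < β₂) (hγ₂ : 0 < γ₂)
    (hlaw₁ : HasLaw h₁ (stdComplexGaussianVec M) μ)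
    (hlaw₂ : HasLaw h₂ (stdComplexGaussianVec M) μ) (hindep : IndepFun h₁ h₂ μ) :
    ∫⁻ ω in {ω | 0 < absCorr (h₁ ω) (h₂ ω)}, minPower β₁ β₂ γ₁ γ₂ (h₁ ω) (h₂ ω) ∂μ = ∞ := by
  refine top_le_iff.1 (le_trans (le_of_eq ?_)
    (lintegral_mono fun ω => le_minPower hβ₂ hγ₂ (h₁ ω) (h₂ ω)))
  rw [lintegral_const_mul' _ _ ENNReal.ofReal_ne_top, setLIntegral_eq_of_support_subset,
    lintegral_inv_sq_norm_inner_matchedFilter hM hlaw₁ hlaw₂ hindep, ENNReal.mul_top]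
  · simpa using div_pos hγ₂ hβ₂
  · -- The real inverse vanishes where the correlation does.
    intro ω hω
    by_contra hneg
    have h0 : absCorr (h₁ ω) (h₂ ω) = 0 :=
      le_antisymm (not_lt.1 hneg) (absCorr_nonneg _ _)
    simp [norm_inner_matchedFilter, h0] at hω

lemma setLIntegral_minPower_le_avgMinPower (t : ℝ) :
    ∫⁻ ω in {ω | t ≤ absCorr (h₁ ω) (h₂ ω)}, minPower β₁ β₂ γ₁ γ₂ (h₁ ω) (h₂ ω) ∂μ ≤
      avgMinPower μ β₁ β₂ γ₁ γ₂ h₁ h₂ t := by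
  rw [avgMinPower, ProbabilityTheory.cond, lintegral_smul_measure, smul_eq_mul]
  exact le_mul_of_one_le_left zero_le (ENNReal.one_le_inv.2 prob_le_one)

lemma tendsto_avgMinPower (hM : 2 ≤ M) (hβ₂ : 0 < β₂) (hγ₂ : 0 < γ₂)
    (hlaw₁ : HasLaw h₁ (stdComplexGaussianVec M) μ)
    (hlaw₂ : HasLaw h₂ (stdComplexGaussianVec M) μ) (hindep : IndepFun h₁ h₂ μ) :
    Tendsto (fun t : ℝ => avgMinPower μ β₁ β₂ γ₁ γ₂ h₁ h₂ t) (𝓝[>] 0) (𝓝 ∞) := by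
  have hanti : Antitone fun t : ℝ => {ω | t ≤ absCorr (h₁ ω) (h₂ ω)} :=
    fun s t hst ω hω => hst.trans hω
  have hunion : {ω | 0 < absCorr (h₁ ω) (h₂ ω)} =
      ⋃ n : ℕ, {ω | 1 / ((n : ℝ) + 1) ≤ absCorr (h₁ ω) (h₂ ω)} := by
    ext ω
    simp only [Set.mem_ofPred_eq, Set.mem_iUnion]
    exact ⟨fun h => (exists_nat_one_div_lt h).imp fun _ hn => hn.le,
      fun ⟨n, hn⟩ => Nat.one_div_pos_of_nat.trans_le hn⟩
  have htop := setLIntegral_minPower_absCorr_pos (β₁ := β₁) (γ₁ := γ₁) hM hβ₂ hγ₂ hlaw₁ hlaw₂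
    hindep
  rw [hunion, setLIntegral_iUnion_of_directed _ (Monotone.directed_le fun m n hmn =>
    hanti (Nat.one_div_le_one_div hmn)), iSup_eq_top] at htop
  refine ENNReal.tendsto_nhds_top fun N => ?_
  obtain ⟨n, hn⟩ := htop N (ENNReal.natCast_lt_top N)
  filter_upwards [Ioo_mem_nhdsGT (Nat.one_div_pos_of_nat (α := ℝ) (n := n))] with t ht
  exact hn.trans_le ((lintegral_mono_set (hanti ht.2.le)).trans
    (setLIntegral_minPower_le_avgMinPower t))

lemma lintegral_minPower_eq_top (hM : 2 ≤ M) (hβ₂ : 0 < β₂) (hγ₂ : 0 < γ₂)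
    (hlaw₁ : HasLaw h₁ (stdComplexGaussianVec M) μ)
    (hlaw₂ : HasLaw h₂ (stdComplexGaussianVec M) μ) (hindep : IndepFun h₁ h₂ μ) :
    ∫⁻ ω, minPower β₁ β₂ γ₁ γ₂ (h₁ ω) (h₂ ω) ∂μ = ∞ :=
  top_le_iff.1 ((setLIntegral_minPower_absCorr_pos hM hβ₂ hγ₂ hlaw₁ hlaw₂ hindep).symm.trans_le
    (setLIntegral_le_lintegral _ _))

end NOMA

theorem corollary1 {Ω : Type*} [MeasurableSpace Ω] (μ : Measure Ω) [IsProbabilityMeasure μ]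
    (M : ℕ) (hM : 2 ≤ M) (β₁ β₂ γ₁ γ₂ : ℝ) (hβ₂ : 0 < β₂) (hβ : β₂ ≤ β₁)
    (hγ₁ : 0 < γ₁) (hγ₂ : 0 < γ₂)
    (h₁ h₂ : Ω → EuclideanSpace ℂ (Fin M))
    (hlaw₁ : HasLaw h₁ (NOMA.stdComplexGaussianVec M) μ)
    (hlaw₂ : HasLaw h₂ (NOMA.stdComplexGaussianVec M) μ)
    (hindep : IndepFun h₁ h₂ μ) :
    -- for a positive threshold the average minimal transmit power is finite
    (∀ ρth : ℝ, 0 < ρth → NOMA.avgMinPower μ β₁ β₂ γ₁ γ₂ h₁ h₂ ρth < ∞) ∧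
    -- it diverges as the threshold tends to zero
    Tendsto (fun ρth : ℝ => NOMA.avgMinPower μ β₁ β₂ γ₁ γ₂ h₁ h₂ ρth) (𝓝[>] 0) (𝓝 ∞) ∧
    -- without a threshold it is infinite
    NOMA.avgMinPower μ β₁ β₂ γ₁ γ₂ h₁ h₂ 0 = ∞ ∧
    -- and then every power allocation that meets the SINR requirements has infinite mean power
    (∀ P₁ P₂ : Ω → ℝ,
      (∀ᵐ ω ∂μ, NOMA.MeetsSINR γ₁ γ₂
        (NOMA.gain β₁ (NOMA.matchedFilter (h₁ ω)) (h₁ ω))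
        (NOMA.gain β₂ (NOMA.matchedFilter (h₁ ω)) (h₂ ω)) (P₁ ω) (P₂ ω)) →
      ∫⁻ ω, ENNReal.ofReal (P₁ ω + P₂ ω) ∂μ = ∞) := by
  have hβ₁ : 0 < β₁ := hβ₂.trans_le hβ
  have htop := NOMA.lintegral_minPower_eq_top (β₁ := β₁) (γ₁ := γ₁) hM hβ₂ hγ₂ hlaw₁ hlaw₂ hindep
  refine ⟨fun t ht => NOMA.avgMinPower_lt_top hM hβ₁ hβ₂ hlaw₁ hlaw₂ ht,
    NOMA.tendsto_avgMinPower hM hβ₂ hγ₂ hlaw₁ hlaw₂ hindep, ?_, fun P₁ P₂ hP => ?_⟩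
  · have huniv : {ω | 0 ≤ NOMA.absCorr (h₁ ω) (h₂ ω)} = Set.univ :=
      Set.eq_univ_of_forall fun ω => NOMA.absCorr_nonneg _ _
    rw [NOMA.avgMinPower, huniv, cond_univ, htop]
  · rw [← top_le_iff, ← htop]
    refine lintegral_mono_ae (hP.mono fun ω hω => ?_)
    rw [NOMA.minPower, NOMA.minPowerOfGains_eq_iInf hγ₁ hγ₂ (NOMA.gain_nonneg hβ₁.le _ _)
      (NOMA.gain_nonneg hβ₂.le _ _)]
    exact (iInf₂_le (P₁ ω) (P₂ ω)).trans (iInf_le _ hω)
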